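/- Consider the $(mm22)$ Bell scenario: two parties, each with $m$ inputs and with two outputs per input. A behaviour is a family $P(ab|xy)\ge 0$ with $\sum_{ab}P(ab|xy)=1$ for all inputs $x,y$. It is no-signalling if $\sum_b P(ab|xy)$ does not depend on $y$ and $\sum_a P(ab|xy)$ does not depend on $x$. It is arranged as the $2m\times 2m$ real matrix $P=\sum_{abxy}P(ab|xy)\,|xa\rangle\langle yb|$, and $\|\cdot\|_1$ denotes the trace norm (the sum of the singular values). A PR box $P_{PR}(m,2)$ is a vertex of the polytope of no-signalling behaviours that is nonlocal, i.e. not in the convex hull of the local deterministic behaviours $\delta_{a,f(x)}\delta_{b,g(y)}$. An input of a party is called deterministic for $P$ if one of its outputs has marginal probability $1$. A behaviour is quantum if $P(ab|xy)=\mathrm{tr}(\rho\,E^x_a\otimes F^y_b)$ for a density operator $\rho$ on the Hilbert space tensor product of two complex Hilbert spaces of arbitrary (possibly infinite) dimension and orthogonal projections with $\sum_aE^x_a=1$ for every $x$ and $\sum_bF^y_b=1$ for every $y$. Theorem 5. For every $m$ and every PR box $P_{PR}(m,2)$ of the $(mm22)$ scenario: (i) if the two parties have equally many deterministic inputs for $P_{PR}(m,2)$,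 in particular if there are none, then $\|P_{PR}(m,2)\|_1\ge m+\sqrt2-1$; (ii) with no restriction on $P_{PR}(m,2)$, $\|P_{PR}(m,2)-P\|_1\ge\sqrt2-1$ for every quantum behaviour $P$. -/

import Mathlib

universe u

open scoped TensorProduct InnerProductSpace

noncomputable section

namespace Bell

/-- Families of numbers `P a b x y = P(ab|xy)` in the bipartite `(mA mB dA dB)` scenario:
`x`, `y` are the inputs of the two parties, `a`, `b` their outputs. -/
abbrev Behaviour (mA mB dA dB : ℕ) : Type :=
  Fin dA → Fin dB → Fin mA → Fin mB → ℝ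

/-- The no-signalling set: normalized non-negative behaviours whose marginals for each party
do not depend on the input of the other party. -/
def noSignalling (mA mB dA dB : ℕ) : Set (Behaviour mA mB dA dB) :=
  {P | (∀ a b x y, 0 ≤ P a b x y) ∧
    (∀ x y, ∑ a, ∑ b, P a b x y = 1) ∧
    (∀ a x y y', ∑ b, P a b x y = ∑ b, P a b x y') ∧
    (∀ b y x x', ∑ a, P a b x y = ∑ a, P a b x' y)}

/-- The local deterministic behaviour in which the outputs are the functions `f`, `g` of the
respective inputs. -/
def localDeterministic {mA mB dA dB : ℕ} (f : Fin mA → Fin dA) (g : Fin mB → Fin dB) :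
    Behaviour mA mB dA dB :=
  fun a b x y => (if a = f x then 1 else 0) * (if b = g y then 1 else 0)

/-- The local set: the convex hull of the local deterministic behaviours. -/
def localSet (mA mB dA dB : ℕ) : Set (Behaviour mA mB dA dB) :=
  convexHull ℝ {P | ∃ f g, P = localDeterministic f g}

/-- A PR box: a vertex of the no-signalling polytope that is not local. -/
def IsPRBox {mA mB dA dB : ℕ} (P : Behaviour mA mB dA dB) : Prop :=
  P ∈ (noSignalling mA mB dA dB).extremePoints ℝ ∧ P ∉ localSet mA mB dA dB

/-- The number of inputs of the first party for which some output has probability one. -/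
def numDeterministicA {mA mB dA dB : ℕ} (P : Behaviour mA mB dA dB) : ℕ :=
  {x : Fin mA | ∃ a, ∀ y, ∑ b, P a b x y = 1}.ncard

/-- The number of inputs of the second party for which some output has probability one. -/
def numDeterministicB {mA mB dA dB : ℕ} (P : Behaviour mA mB dA dB) : ℕ :=
  {y : Fin mB | ∃ b, ∀ x, ∑ a, P a b x y = 1}.ncard

/-- The matrix `∑ P(ab|xy) |xa⟩⟨yb|` of a behaviour. -/
def Behaviour.toMatrix {mA mB dA dB : ℕ} (P : Behaviour mA mB dA dB) :
    Matrix (Fin mA × Fin dA) (Fin mB × Fin dB) ℝ :=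
  Matrix.of fun r c => P r.2 c.2 r.1 c.1

/-- The trace norm of a real matrix: the sum of its singular values. -/
def traceNorm {m n : Type*} [Fintype m] [Fintype n] [DecidableEq n] (M : Matrix m n ℝ) : ℝ :=
  (Matrix.toEuclideanLin M).singularValues.sum fun _ s => s

/-- The Hilbert space tensor product: the completion of the algebraic tensor product. -/
abbrev HilbertTensor (HA HB : Type u)
    [NormedAddCommGroup HA] [InnerProductSpace ℂ HA]
    [NormedAddCommGroup HB] [InnerProductSpace ℂ HB] : Type u :=
  UniformSpace.Completion (HA ⊗[ℂ] HB)

/-- The bounded operator `E ⊗ F` on the Hilbert space tensor product. -/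
def tensorOp {HA HB : Type u}
    [NormedAddCommGroup HA] [InnerProductSpace ℂ HA]
    [NormedAddCommGroup HB] [InnerProductSpace ℂ HB]
    (E : HA →L[ℂ] HA) (F : HB →L[ℂ] HB) :
    HilbertTensor HA HB →L[ℂ] HilbertTensor HA HB :=
  (TensorProduct.mapL E F).completion

/-- `T` has trace `t`: in every Hilbert basis the sum of the diagonal matrix elements converges
unconditionally to `t`. -/
def HasTrace {H : Type u} [NormedAddCommGroup H] [InnerProductSpace ℂ H]
    (T : H →L[ℂ] H) (t : ℂ) : Prop :=
  ∀ (ι : Type u) (e : HilbertBasis ι ℂ H), HasSum (fun i => ⟪e i, T (e i)⟫_ℂ) t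

/-- Density operators: positive operators of trace one. -/
def IsDensityOperator {H : Type u} [NormedAddCommGroup H] [InnerProductSpace ℂ H]
    (ρ : H →L[ℂ] H) : Prop :=
  ρ.IsPositive ∧ HasTrace ρ 1

/-- A projective measurement: orthogonal projections adding up to the identity. -/
def IsProjectiveMeasurement {H : Type u} [NormedAddCommGroup H] [InnerProductSpace ℂ H]
    [CompleteSpace H] {d : ℕ} (E : Fin d → H →L[ℂ] H) : Prop :=
  (∀ a, IsStarProjection (E a)) ∧ ∑ a, E a = 1

/-- The quantum set: all behaviours `P(ab|xy) = tr (ρ (E_a^x ⊗ F_b^y))` with `ρ` a state on the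
tensor product of two complex Hilbert spaces of arbitrary, possibly infinite, dimension and
`E^x`, `F^y` projective measurements. -/
def quantumSet (mA mB dA dB : ℕ) : Set (Behaviour mA mB dA dB) :=
  {P | ∃ (HA HB : Type u)
    (_ : NormedAddCommGroup HA) (_ : InnerProductSpace ℂ HA) (_ : CompleteSpace HA)
    (_ : NormedAddCommGroup HB) (_ : InnerProductSpace ℂ HB) (_ : CompleteSpace HB)
    (ρ : HilbertTensor HA HB →L[ℂ] HilbertTensor HA HB)
    (E : Fin mA → Fin dA → HA →L[ℂ] HA) (F : Fin mB → Fin dB → HB →L[ℂ] HB),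
    IsDensityOperator ρ ∧
    (∀ x, IsProjectiveMeasurement (E x)) ∧ (∀ y, IsProjectiveMeasurement (F y)) ∧
    ∀ a b x y, HasTrace (ρ * tensorOp (E x a) (F y b)) (P a b x y : ℂ)}

end Bell

end

/-! With two outputs of signs a, b = ±1, a no-signalling behaviour is (1 + aA_x + bB_y + abC_xy)/4.
Rigidity of a vertex forces A and B into {0, ±1}, and C_xy = ±1 where both marginals vanish;
positivity gives C_xy = A_x B_y where either is ±1. If the sign matrix C on the uniform inputs had
rank one, the box would be a mixture of two deterministic behaviours. So a nonlocal vertex contains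
two rows and two columns whose four signs multiply to -1 (`IsPRBox.exists_ofCorrelators`).

Both bounds come from duality: ∑ W_ij M_ij ≤ ‖M‖₁ for every contraction W (`sum_mul_le_traceNorm`).
W is a sum of pieces of Frobenius norm at most one with mutually orthogonal ranges and coranges, so
the values of the pieces add up (`sum_le_traceNorm`).

For (ii), the pieces are the two rows of the CHSH block, orthogonal because the block is frustrated.
They give √2 on the box, and CHSH/(2√2) ≤ 1 on a quantum behaviour by Tsirelson's bound.

For (i), with k deterministic inputs on each side, two pieces are added: a rank-one matrix built
from the marginals, worth (m+k)/2, and the signs on the uniform inputs outside the block, worth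
(m-k-2)/2. The total is m - 1 + √2. -/

namespace Bell

noncomputable section

/-! ### Positivity of the trace of a product of positive operators in arbitrary dimension. -/

section Trace

variable {H : Type u} [NormedAddCommGroup H] [InnerProductSpace ℂ H]

theorem hasSum_norm_inner_sq {ι : Type*} (e : HilbertBasis ι ℂ H) (x : H) :
    HasSum (fun i => ‖⟪e i, x⟫_ℂ‖ ^ 2) (‖x‖ ^ 2) := by
  have h := (e.hasSum_inner_mul_inner x x).mapL Complex.reCLM
  convert! h using 2
  · rename_i i
    rw [← inner_conj_symm x (e i), Complex.reCLM_apply, ← Complex.normSq_eq_conj_mul_self,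
      Complex.ofReal_re, Complex.normSq_eq_norm_sq]
  · exact (inner_self_eq_norm_sq (𝕜 := ℂ) x).symm

theorem summable_norm_inner_sq_prod {ι : Type*} (e : HilbertBasis ι ℂ H)
    {v : ι → H} (hv : Summable fun i => ‖v i‖ ^ 2) :
    Summable fun p : ι × ι => ‖⟪e p.2, v p.1⟫_ℂ‖ ^ 2 := by
  rw [summable_prod_of_nonneg (fun _ => by positivity)]
  refine ⟨fun j => (hasSum_norm_inner_sq e (v j)).summable, ?_⟩
  simpa only [fun j => (hasSum_norm_inner_sq e (v j)).tsum_eq] using hv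

/-- The double series computing `∑ ⟪u j, v j⟫` in a Hilbert basis converges absolutely. -/
theorem summable_inner_mul_inner_prod {ι : Type*} (e : HilbertBasis ι ℂ H)
    {u v : ι → H} (hu : Summable fun i => ‖u i‖ ^ 2) (hv : Summable fun i => ‖v i‖ ^ 2) :
    Summable fun p : ι × ι => ⟪u p.1, e p.2⟫_ℂ * ⟪e p.2, v p.1⟫_ℂ := by
  refine Summable.of_norm_bounded ((summable_norm_inner_sq_prod e hu).add
    (summable_norm_inner_sq_prod e hv)) fun p => ?_
  rw [norm_mul, norm_inner_symm]
  nlinarith [sq_nonneg (‖⟪e p.2, u p.1⟫_ℂ‖ - ‖⟪e p.2, v p.1⟫_ℂ‖),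
    sq_nonneg (‖⟪e p.2, u p.1⟫_ℂ‖ + ‖⟪e p.2, v p.1⟫_ℂ‖)]

variable [CompleteSpace H]

theorem exists_isSelfAdjoint_mul_self_eq {ρ : H →L[ℂ] H} (hρ : ρ.IsPositive) :
    ∃ R : H →L[ℂ] H, IsSelfAdjoint R ∧ R * R = ρ := by
  have h : (0 : H →L[ℂ] H) ≤ ρ := (ContinuousLinearMap.nonneg_iff_isPositive ρ).2 hρ
  exact ⟨CFC.sqrt ρ, (CFC.sqrt_nonneg ρ).isSelfAdjoint, CFC.sqrt_mul_sqrt_self ρ h⟩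

/-- For positive `ρ`, `S` with `ρ` of trace class, the trace of `ρ S` is nonnegative. -/
theorem re_nonneg_of_hasSum_inner_mul {ι : Type*} (e : HilbertBasis ι ℂ H) {ρ S : H →L[ℂ] H}
    (hρ : ρ.IsPositive) (hS : S.IsPositive) {r t : ℂ}
    (hr : HasSum (fun i => ⟪e i, ρ (e i)⟫_ℂ) r)
    (ht : HasSum (fun i => ⟪e i, (ρ * S) (e i)⟫_ℂ) t) : 0 ≤ t.re := by
  obtain ⟨R, hR, rfl⟩ := exists_isSelfAdjoint_mul_self_eq hρ
  have hRs : ∀ x y, ⟪R x, y⟫_ℂ = ⟪x, R y⟫_ℂ := hR.isSymmetric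
  have hSs : ∀ x y, ⟪S x, y⟫_ℂ = ⟪x, S y⟫_ℂ := hS.isSymmetric
  -- Finite trace of `R * R` means that `R` is Hilbert–Schmidt; hence so is `S * R`.
  have hsum : Summable fun i => ‖R (e i)‖ ^ 2 := by
    have h := (hr.mapL Complex.reCLM).summable
    convert! h using 2 with i
    rw [Complex.reCLM_apply, mul_apply_eq_comp, ← hRs]
    exact (inner_self_eq_norm_sq (𝕜 := ℂ) _).symm
  have hsum' : Summable fun i => ‖S (R (e i))‖ ^ 2 := by
    refine Summable.of_nonneg_of_le (fun _ => by positivity) (fun i => ?_)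
      (hsum.mul_left (‖S‖ ^ 2))
    rw [← mul_pow]
    gcongr
    exact S.le_opNorm _
  have hfs := summable_inner_mul_inner_prod e hsum' hsum
  -- Cyclicity of the trace: the same absolutely convergent double series, summed in one order,
  -- gives the nonnegative terms of tr(RSR), and in the other order the terms of tr(ρS).
  have h1 : HasSum (fun j => ⟪S (R (e j)), R (e j)⟫_ℂ) _ :=
    hfs.hasSum.prod_fiberwise fun j => e.hasSum_inner_mul_inner (S (R (e j))) (R (e j))
  have h2 : HasSum (fun i => ⟪e i, (R * R * S) (e i)⟫_ℂ)
      (∑' p : ι × ι, ⟪S (R (e p.1)), e p.2⟫_ℂ * ⟪e p.2, R (e p.1)⟫_ℂ) := by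
    refine ((Equiv.prodComm ι ι).hasSum_iff.2 hfs.hasSum).prod_fiberwise fun i => ?_
    have h3 := e.hasSum_inner_mul_inner (R (e i)) (R (S (e i)))
    have h4 : ⟪R (e i), R (S (e i))⟫_ℂ = ⟪e i, (R * R * S) (e i)⟫_ℂ := by
      rw [hRs]; rfl
    rw [h4] at h3
    refine h3.congr_fun fun j => ?_
    simp only [Function.comp, Equiv.prodComm_apply, Prod.fst_swap, Prod.snd_swap]
    rw [hSs, hRs, hRs, mul_comm]
  rw [ht.unique h2]
  exact (h1.mapL Complex.reCLM).nonneg fun j => hS.re_inner_nonneg_left (R (e j))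

end Trace

/-! ### Algebra of the operators E ⊗ F on the completed tensor product. -/

section Tensor

variable {HA HB : Type u}
    [NormedAddCommGroup HA] [InnerProductSpace ℂ HA]
    [NormedAddCommGroup HB] [InnerProductSpace ℂ HB]

theorem tensorOp_coe (E : HA →L[ℂ] HA) (F : HB →L[ℂ] HB) (x : HA ⊗[ℂ] HB) :
    tensorOp E F (x : HilbertTensor HA HB) = (TensorProduct.mapL E F x : HA ⊗[ℂ] HB) :=
  ContinuousLinearMap.completion_apply_coe _ _

theorem hilbertTensor_ext {S T : HilbertTensor HA HB →L[ℂ] HilbertTensor HA HB}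
    (h : ∀ x : HA ⊗[ℂ] HB, S x = T x) : S = T := by
  ext z
  induction z using UniformSpace.Completion.induction_on with
  | hp => exact isClosed_eq S.continuous T.continuous
  | ih x => exact h x

theorem tensorOp_sub_left (E E' : HA →L[ℂ] HA) (F : HB →L[ℂ] HB) :
    tensorOp (E - E') F = tensorOp E F - tensorOp E' F := by
  refine eq_sub_of_add_eq (hilbertTensor_ext fun x => ?_)
  rw [add_apply, tensorOp_coe, tensorOp_coe, tensorOp_coe,
    ← UniformSpace.Completion.coe_add, ← add_apply, ← TensorProduct.mapL_add_left, sub_add_cancel]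

theorem tensorOp_sub_right (E : HA →L[ℂ] HA) (F F' : HB →L[ℂ] HB) :
    tensorOp E (F - F') = tensorOp E F - tensorOp E F' := by
  refine eq_sub_of_add_eq (hilbertTensor_ext fun x => ?_)
  rw [add_apply, tensorOp_coe, tensorOp_coe, tensorOp_coe,
    ← UniformSpace.Completion.coe_add, ← add_apply, ← TensorProduct.mapL_add_right, sub_add_cancel]

theorem tensorOp_mul (E E' : HA →L[ℂ] HA) (F F' : HB →L[ℂ] HB) :
    tensorOp (E * E') (F * F') = tensorOp E F * tensorOp E' F' := by
  refine hilbertTensor_ext fun x => ?_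
  rw [mul_apply_eq_comp, tensorOp_coe, tensorOp_coe, tensorOp_coe,
    TensorProduct.mapL_mul]
  rfl

theorem tensorOp_one : tensorOp (1 : HA →L[ℂ] HA) (1 : HB →L[ℂ] HB) = 1 := by
  refine hilbertTensor_ext fun x => ?_
  rw [tensorOp_coe]
  exact congrArg _ (DFunLike.congr_fun TensorProduct.mapL_id_id x)

theorem inner_mapL_left [CompleteSpace HA] [CompleteSpace HB] {E : HA →L[ℂ] HA}
    {F : HB →L[ℂ] HB} (hE : IsSelfAdjoint E) (hF : IsSelfAdjoint F) (x y : HA ⊗[ℂ] HB) :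
    ⟪TensorProduct.mapL E F x, y⟫_ℂ = ⟪x, TensorProduct.mapL E F y⟫_ℂ := by
  induction x with
  | zero => simp
  | add x x' hx hx' => rw [map_add, inner_add_left, inner_add_left, hx, hx']
  | tmul a b =>
    induction y with
    | zero => simp
    | add y y' hy hy' => rw [map_add, inner_add_right, inner_add_right, hy, hy']
    | tmul c d =>
      have h1 : ⟪E a, c⟫_ℂ = ⟪a, E c⟫_ℂ := hE.isSymmetric a c
      have h2 : ⟪F b, d⟫_ℂ = ⟪b, F d⟫_ℂ := hF.isSymmetric b d
      simp [h1, h2]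

theorem isSelfAdjoint_tensorOp [CompleteSpace HA] [CompleteSpace HB] {E : HA →L[ℂ] HA}
    {F : HB →L[ℂ] HB} (hE : IsSelfAdjoint E) (hF : IsSelfAdjoint F) :
    IsSelfAdjoint (tensorOp E F) := by
  rw [ContinuousLinearMap.isSelfAdjoint_iff_isSymmetric]
  intro z w
  induction z, w using UniformSpace.Completion.induction_on₂ with
  | hp =>
    exact isClosed_eq (((tensorOp E F).continuous.comp continuous_fst).inner continuous_snd)
      (continuous_fst.inner ((tensorOp E F).continuous.comp continuous_snd))
  | ih x y =>
    simp only [ContinuousLinearMap.coe_coe, tensorOp_coe, UniformSpace.Completion.inner_coe]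
    exact inner_mapL_left hE hF x y

end Tensor

/-! ### Tsirelson's bound. -/

theorem isSelfAdjoint_sub_smul_add {R : Type*} [Ring R] [StarRing R] [Module ℝ R]
    [StarModule ℝ R] {A B B' : R} (hA : IsSelfAdjoint A) (hB : IsSelfAdjoint B)
    (hB' : IsSelfAdjoint B') (t c c' : ℝ) : IsSelfAdjoint (A - t • (c • B + c' • B')) :=
  hA.sub ((IsSelfAdjoint.all t).smul
    (((IsSelfAdjoint.all c).smul hB).add ((IsSelfAdjoint.all c').smul hB')))

/-- Tsirelson's inequality as a sum of squares, for a CHSH expression with signs `c`. -/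
theorem sum_sq_eq_of_chsh {R : Type*} [Ring R] [Algebra ℝ R] {A₀ A₁ B₀ B₁ : R}
    (hA₀ : A₀ * A₀ = 1) (hA₁ : A₁ * A₁ = 1) (hB₀ : B₀ * B₀ = 1) (hB₁ : B₁ * B₁ = 1)
    (h₀₀ : B₀ * A₀ = A₀ * B₀) (h₀₁ : B₁ * A₀ = A₀ * B₁)
    (h₁₀ : B₀ * A₁ = A₁ * B₀) (h₁₁ : B₁ * A₁ = A₁ * B₁)
    {c₀₀ c₀₁ c₁₀ c₁₁ : ℝ} (k₀₀ : c₀₀ ^ 2 = 1) (k₀₁ : c₀₁ ^ 2 = 1) (k₁₀ : c₁₀ ^ 2 = 1)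
    (k₁₁ : c₁₁ ^ 2 = 1) (hc : c₀₀ * c₀₁ = -(c₁₀ * c₁₁)) {t : ℝ} (ht : t ^ 2 = 1 / 2) :
    (A₀ - t • (c₀₀ • B₀ + c₀₁ • B₁)) * (A₀ - t • (c₀₀ • B₀ + c₀₁ • B₁)) +
      (A₁ - t • (c₁₀ • B₀ + c₁₁ • B₁)) * (A₁ - t • (c₁₀ • B₀ + c₁₁ • B₁)) =
    (4 : ℝ) • 1 - (2 * t) • (c₀₀ • (A₀ * B₀) + c₀₁ • (A₀ * B₁) + c₁₀ • (A₁ * B₀) +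
      c₁₁ • (A₁ * B₁)) := by
  simp only [mul_sub, sub_mul, mul_add, add_mul, smul_mul_assoc, mul_smul_comm, hA₀, hA₁, hB₀,
    hB₁, h₀₀, h₀₁, h₁₀, h₁₁, smul_add]
  -- The coefficient of 1 is 2 + 4t² = 4. Those of B₀B₁ and B₁B₀ vanish by `hc`, which says that the
  -- four signs multiply to -1.
  match_scalars
  · linear_combination 4 * ht + t ^ 2 * (k₀₀ + k₀₁ + k₁₀ + k₁₁)
  · ring
  · ring
  · linear_combination t ^ 2 * hc
  · linear_combination t ^ 2 * hc
  · ring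
  · ring

/-- The sign `±1` attached to an output. -/
def outcomeSign : Fin 2 → ℝ := ![1, -1]

/-- The correlator `⟨A_x B_y⟩`. -/
def correlator {mA mB : ℕ} (P : Behaviour mA mB 2 2) (x : Fin mA) (y : Fin mB) : ℝ :=
  ∑ a, ∑ b, outcomeSign a * outcomeSign b * P a b x y

section Observable

variable {H : Type u} [NormedAddCommGroup H] [InnerProductSpace ℂ H] [CompleteSpace H]
  {E : Fin 2 → H →L[ℂ] H}

theorem IsProjectiveMeasurement.isSelfAdjoint_sub (hE : IsProjectiveMeasurement E) :
    IsSelfAdjoint (E 0 - E 1) :=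
  (hE.1 0).isSelfAdjoint.sub (hE.1 1).isSelfAdjoint

theorem IsProjectiveMeasurement.sub_mul_self (hE : IsProjectiveMeasurement E) :
    (E 0 - E 1) * (E 0 - E 1) = 1 := by
  have h : E 1 = 1 - E 0 := eq_sub_of_add_eq' (by simpa [Fin.sum_univ_two] using hE.2)
  have h0 : E 0 * E 0 = E 0 := (hE.1 0).isIdempotentElem
  simp only [h, mul_sub, sub_mul, h0, mul_one, one_mul]
  abel

end Observable

/-- Tsirelson's bound for expectation values in a state of commuting `±1`-valued observables. -/
theorem chsh_le_of_hasSum {H : Type u} [NormedAddCommGroup H] [InnerProductSpace ℂ H]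
    [CompleteSpace H] {ι : Type*} (e : HilbertBasis ι ℂ H) {ρ : H →L[ℂ] H} (hρ : ρ.IsPositive)
    (hρ1 : HasSum (fun i => ⟪e i, ρ (e i)⟫_ℂ) 1) {A₀ A₁ B₀ B₁ : H →L[ℂ] H}
    (sA₀ : IsSelfAdjoint A₀) (sA₁ : IsSelfAdjoint A₁) (sB₀ : IsSelfAdjoint B₀)
    (sB₁ : IsSelfAdjoint B₁)
    (hA₀ : A₀ * A₀ = 1) (hA₁ : A₁ * A₁ = 1) (hB₀ : B₀ * B₀ = 1) (hB₁ : B₁ * B₁ = 1)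
    (h₀₀ : B₀ * A₀ = A₀ * B₀) (h₀₁ : B₁ * A₀ = A₀ * B₁)
    (h₁₀ : B₀ * A₁ = A₁ * B₀) (h₁₁ : B₁ * A₁ = A₁ * B₁)
    {c₀₀ c₀₁ c₁₀ c₁₁ : ℝ} (k₀₀ : c₀₀ ^ 2 = 1) (k₀₁ : c₀₁ ^ 2 = 1) (k₁₀ : c₁₀ ^ 2 = 1)
    (k₁₁ : c₁₁ ^ 2 = 1) (hc : c₀₀ * c₀₁ = -(c₁₀ * c₁₁)) {q₀₀ q₀₁ q₁₀ q₁₁ : ℝ}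
    (t₀₀ : HasSum (fun i => ⟪e i, (ρ * (A₀ * B₀)) (e i)⟫_ℂ) (q₀₀ : ℂ))
    (t₀₁ : HasSum (fun i => ⟪e i, (ρ * (A₀ * B₁)) (e i)⟫_ℂ) (q₀₁ : ℂ))
    (t₁₀ : HasSum (fun i => ⟪e i, (ρ * (A₁ * B₀)) (e i)⟫_ℂ) (q₁₀ : ℂ))
    (t₁₁ : HasSum (fun i => ⟪e i, (ρ * (A₁ * B₁)) (e i)⟫_ℂ) (q₁₁ : ℂ)) :
    c₀₀ * q₀₀ + c₀₁ * q₀₁ + c₁₀ * q₁₀ + c₁₁ * q₁₁ ≤ 2 * √2 := by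
  have h2 : √2 ^ 2 = 2 := Real.sq_sqrt (by norm_num)
  have ht2 : (√2 / 2) ^ 2 = 1 / 2 := by rw [div_pow, h2]; norm_num
  have hsqpos : ∀ {T : H →L[ℂ] H}, IsSelfAdjoint T → (T * T).IsPositive := fun {T} hT => by
    rw [← ContinuousLinearMap.nonneg_iff_isPositive]
    exact hT.mul_self_nonneg
  have hpos := (hsqpos (isSelfAdjoint_sub_smul_add sA₀ sB₀ sB₁ (√2 / 2) c₀₀ c₀₁)).add
    (hsqpos (isSelfAdjoint_sub_smul_add sA₁ sB₀ sB₁ (√2 / 2) c₁₀ c₁₁))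
  rw [sum_sq_eq_of_chsh hA₀ hA₁ hB₀ hB₁ h₀₀ h₀₁ h₁₀ h₁₁ k₀₀ k₀₁ k₁₀ k₁₁ hc ht2] at hpos
  have hsum : HasSum (fun i => ⟪e i, (ρ * ((4 : ℝ) • 1 - (2 * (√2 / 2)) • (c₀₀ • (A₀ * B₀) +
      c₀₁ • (A₀ * B₁) + c₁₀ • (A₁ * B₀) + c₁₁ • (A₁ * B₁)))) (e i)⟫_ℂ)
      ((4 - 2 * (√2 / 2) * (c₀₀ * q₀₀ + c₀₁ * q₀₁ + c₁₀ * q₁₀ + c₁₁ * q₁₁) : ℝ) : ℂ) := by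
    have h := (hρ1.mul_left (4 : ℂ)).sub
      (((((t₀₀.mul_left (c₀₀ : ℂ)).add (t₀₁.mul_left (c₀₁ : ℂ))).add
        (t₁₀.mul_left (c₁₀ : ℂ))).add (t₁₁.mul_left (c₁₁ : ℂ))).mul_left
          ((2 * (√2 / 2) : ℝ) : ℂ))
    convert! h using 2
    · simp only [mul_sub, mul_add, mul_smul_comm, mul_one, sub_apply, add_apply, smul_apply,
        inner_sub_right, inner_add_right, ← Complex.coe_smul, inner_smul_right]
      push_cast
      ring
    · push_cast
      ring
  -- With t = 1/√2 the trace of the sum of squares is 4 - √2·CHSH, so CHSH ≤ 4/√2 = 2√2.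
  have := re_nonneg_of_hasSum_inner_mul e hρ hpos hρ1 hsum
  rw [Complex.ofReal_re] at this
  nlinarith [Real.sqrt_pos.2 (show (0 : ℝ) < 2 by norm_num)]

/-- Tsirelson's bound for CHSH expressions of quantum behaviours. -/
theorem chsh_le_of_mem_quantumSet {mA mB : ℕ} {Q : Behaviour mA mB 2 2}
    (hQ : Q ∈ quantumSet.{u} mA mB 2 2) (x₀ x₁ : Fin mA) (y₀ y₁ : Fin mB)
    {c₀₀ c₀₁ c₁₀ c₁₁ : ℝ} (k₀₀ : c₀₀ ^ 2 = 1) (k₀₁ : c₀₁ ^ 2 = 1) (k₁₀ : c₁₀ ^ 2 = 1)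
    (k₁₁ : c₁₁ ^ 2 = 1) (hc : c₀₀ * c₀₁ = -(c₁₀ * c₁₁)) :
    c₀₀ * correlator Q x₀ y₀ + c₀₁ * correlator Q x₀ y₁ + c₁₀ * correlator Q x₁ y₀ +
      c₁₁ * correlator Q x₁ y₁ ≤ 2 * √2 := by
  obtain ⟨HA, HB, _, _, _, _, _, _, ρ, E, F, ⟨hρ, hρ1⟩, hE, hF, hQ⟩ := hQ
  obtain ⟨w, e, -⟩ := exists_hilbertBasis ℂ (HilbertTensor HA HB)
  have hAB : ∀ x y, tensorOp (E x 0 - E x 1) 1 * tensorOp 1 (F y 0 - F y 1) =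
      tensorOp (E x 0 - E x 1) (F y 0 - F y 1) := fun x y => by
    rw [← tensorOp_mul, mul_one, one_mul]
  have hBA : ∀ x y, tensorOp 1 (F y 0 - F y 1) * tensorOp (E x 0 - E x 1) 1 =
      tensorOp (E x 0 - E x 1) 1 * tensorOp 1 (F y 0 - F y 1) := fun x y => by
    rw [hAB, ← tensorOp_mul, mul_one, one_mul]
  have hA2 : ∀ x, tensorOp (E x 0 - E x 1) (1 : HB →L[ℂ] HB) *
      tensorOp (E x 0 - E x 1) 1 = 1 := fun x => by
    rw [← tensorOp_mul, (hE x).sub_mul_self, one_mul, tensorOp_one]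
  have hB2 : ∀ y, tensorOp (1 : HA →L[ℂ] HA) (F y 0 - F y 1) *
      tensorOp 1 (F y 0 - F y 1) = 1 := fun y => by
    rw [← tensorOp_mul, (hF y).sub_mul_self, one_mul, tensorOp_one]
  have hAs : ∀ x, IsSelfAdjoint (tensorOp (E x 0 - E x 1) (1 : HB →L[ℂ] HB)) := fun x =>
    isSelfAdjoint_tensorOp (hE x).isSelfAdjoint_sub (.one _)
  have hBs : ∀ y, IsSelfAdjoint (tensorOp (1 : HA →L[ℂ] HA) (F y 0 - F y 1)) := fun y =>
    isSelfAdjoint_tensorOp (.one _) (hF y).isSelfAdjoint_sub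
  have htr : ∀ x y, HasSum (fun i => ⟪e i, (ρ * (tensorOp (E x 0 - E x 1) (1 : HB →L[ℂ] HB) *
      tensorOp (1 : HA →L[ℂ] HA) (F y 0 - F y 1))) (e i)⟫_ℂ) (correlator Q x y : ℂ) := by
    intro x y
    have h := (((hQ 0 0 x y _ e).sub (hQ 0 1 x y _ e)).sub (hQ 1 0 x y _ e)).add
      (hQ 1 1 x y _ e)
    convert! h using 2
    · rw [hAB, tensorOp_sub_left, tensorOp_sub_right, tensorOp_sub_right]
      simp only [mul_sub, sub_apply, inner_sub_right]
      ring
    · simp [correlator, Fin.sum_univ_two, outcomeSign]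
      ring
  exact chsh_le_of_hasSum e hρ (hρ1 _ e) (hAs x₀) (hAs x₁) (hBs y₀) (hBs y₁) (hA2 x₀) (hA2 x₁)
    (hB2 y₀) (hB2 y₁) (hBA x₀ y₀) (hBA x₀ y₁) (hBA x₁ y₀) (hBA x₁ y₁) k₀₀ k₀₁ k₁₀ k₁₁ hc
    (htr x₀ y₀) (htr x₀ y₁) (htr x₁ y₀) (htr x₁ y₁)

/-! ### Lower bounds on the trace norm by duality. -/

section TraceNorm

open Matrix

variable {m n : Type*} [Fintype m] [Fintype n]

/-- In an eigenbasis of MᵀM the squared norms ‖M b_i‖² are the eigenvalues, that is, the squared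
singular values. -/
theorem traceNorm_eq_sum_norm [DecidableEq n] (M : Matrix m n ℝ) :
    ∃ b : OrthonormalBasis (Fin (Module.finrank ℝ (EuclideanSpace ℝ n))) ℝ (EuclideanSpace ℝ n),
      traceNorm M = ∑ i, ‖toEuclideanLin M (b i)‖ := by
  set T := toEuclideanLin M with hT
  refine ⟨T.isSymmetric_adjoint_comp_self.eigenvectorBasis rfl, ?_⟩
  -- The singular values form a sequence indexed by ℕ that vanishes from the dimension of the domain
  -- on.
  have hsub : T.singularValues.support ⊆ Finset.range (Module.finrank ℝ (EuclideanSpace ℝ n)) := by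
    intro i hi
    by_contra h
    exact (Finsupp.mem_support_iff.1 hi)
      (T.singularValues_of_finrank_le (by simpa using h))
  rw [traceNorm, ← hT, Finsupp.sum_of_support_subset _ hsub _ (fun _ _ => rfl), Finset.sum_range]
  refine Finset.sum_congr rfl fun i _ => ?_
  refine (pow_left_inj₀ (T.singularValues_nonneg _) (norm_nonneg _) two_ne_zero).1 ?_
  rw [T.sq_singularValues_fin rfl, ← real_inner_self_eq_norm_sq, ← LinearMap.adjoint_inner_right,
    ← LinearMap.comp_apply, T.isSymmetric_adjoint_comp_self.apply_eigenvectorBasis,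
    inner_smul_right, real_inner_self_eq_norm_sq, OrthonormalBasis.norm_eq_one]
  simp

/-- Duality between the trace norm and the operator norm. -/
theorem sum_mul_le_traceNorm [DecidableEq n] (M W : Matrix m n ℝ)
    (hW : ∀ z : n → ℝ, W *ᵥ z ⬝ᵥ W *ᵥ z ≤ z ⬝ᵥ z) :
    ∑ i, ∑ j, W i j * M i j ≤ traceNorm M := by
  classical
  obtain ⟨b, hb⟩ := traceNorm_eq_sum_norm M
  have hnorm : ∀ z, ‖toEuclideanLin W z‖ ≤ ‖z‖ := fun z => by
    refine le_of_sq_le_sq ?_ (norm_nonneg _)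
    rw [← real_inner_self_eq_norm_sq, ← real_inner_self_eq_norm_sq]
    rw [EuclideanSpace.inner_eq_star_dotProduct, EuclideanSpace.inner_eq_star_dotProduct]
    exact hW z.ofLp
  have htr : LinearMap.trace ℝ _ (LinearMap.adjoint (toEuclideanLin W) ∘ₗ toEuclideanLin M) =
      ∑ i, ∑ j, W i j * M i j := by
    rw [LinearMap.trace_eq_sum_inner _ (EuclideanSpace.basisFun n ℝ), Finset.sum_comm]
    refine Finset.sum_congr rfl fun j _ => ?_
    rw [LinearMap.comp_apply, LinearMap.adjoint_inner_right]
    simp [EuclideanSpace.inner_eq_star_dotProduct, dotProduct, mul_comm]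
  -- tr(WᵀM) does not depend on the basis: the standard basis gave the entrywise sum, and `b` gives
  -- terms ⟪W b_i, M b_i⟫ ≤ ‖M b_i‖.
  rw [hb, ← htr, LinearMap.trace_eq_sum_inner _ b]
  refine Finset.sum_le_sum fun i _ => ?_
  rw [LinearMap.comp_apply, LinearMap.adjoint_inner_right]
  refine (real_inner_le_norm _ _).trans (mul_le_of_le_one_left (norm_nonneg _) ?_)
  exact (hnorm _).trans_eq (b.norm_eq_one i)

/-- The operator norm is at most the Frobenius norm, by Cauchy–Schwarz in each row. -/
theorem mulVec_dotProduct_self_le {A : Matrix m n ℝ} (hA : ∑ i, ∑ j, A i j ^ 2 ≤ 1) (z : n → ℝ) :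
    A *ᵥ z ⬝ᵥ A *ᵥ z ≤ z ⬝ᵥ z := by
  have hz : 0 ≤ z ⬝ᵥ z := Finset.sum_nonneg fun i _ => mul_self_nonneg _
  calc A *ᵥ z ⬝ᵥ A *ᵥ z ≤ ∑ i, (∑ j, A i j ^ 2) * (z ⬝ᵥ z) := by
        refine Finset.sum_le_sum fun i _ => ?_
        have := Finset.sum_mul_sq_le_sq_mul_sq Finset.univ (A i) z
        simpa [mulVec, dotProduct, sq] using this
    _ ≤ z ⬝ᵥ z := by
        rw [← Finset.sum_mul]
        exact mul_le_of_le_one_left hz hA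

/-- A sum of matrices with orthogonal ranges and coranges and of Frobenius norm at most one is a
contraction. -/
theorem sum_mulVec_dotProduct_self_le {ι : Type*} [Fintype ι] (W : ι → Matrix m n ℝ)
    (hF : ∀ k, ∑ i, ∑ j, W k i j ^ 2 ≤ 1)
    (hl : ∀ k l, k ≠ l → (W k)ᵀ * W l = 0)
    (hr : ∀ k l, k ≠ l → W k * (W l)ᵀ = 0) (z : n → ℝ) :
    (∑ k, W k) *ᵥ z ⬝ᵥ (∑ k, W k) *ᵥ z ≤ z ⬝ᵥ z := by
  classical
  have h1 : (∑ k, W k) *ᵥ z ⬝ᵥ (∑ k, W k) *ᵥ z = ∑ k, W k *ᵥ z ⬝ᵥ W k *ᵥ z := by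
    simp only [sum_mulVec, sum_dotProduct, dotProduct_sum]
    refine Finset.sum_congr rfl fun k _ => Finset.sum_eq_single k (fun l _ hkl => ?_) (by simp)
    rw [dotProduct_mulVec, vecMul_mulVec, hl l k hkl, vecMul_zero, zero_dotProduct]
  set s := ∑ k, W k *ᵥ z ⬝ᵥ W k *ᵥ z with hs
  -- Here g = WᵀWz for the total W. Then ⟨g, z⟩ = s, and ‖g‖² ≤ s since the coranges are orthogonal
  -- and each transpose is a contraction. Cauchy–Schwarz gives s² ≤ s‖z‖².
  set g := ∑ k, (W k)ᵀ *ᵥ (W k *ᵥ z) with hg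
  have hgz : g ⬝ᵥ z = s := by
    rw [hg, hs, sum_dotProduct]
    refine Finset.sum_congr rfl fun k _ => ?_
    rw [mulVec_transpose, dotProduct_mulVec]
  have hgg : g ⬝ᵥ g ≤ s := by
    have : g ⬝ᵥ g = ∑ k, (W k)ᵀ *ᵥ (W k *ᵥ z) ⬝ᵥ (W k)ᵀ *ᵥ (W k *ᵥ z) := by
      simp only [hg, sum_dotProduct, dotProduct_sum]
      refine Finset.sum_congr rfl fun k _ => Finset.sum_eq_single k (fun l _ hkl => ?_) (by simp)
      rw [dotProduct_mulVec, vecMul_mulVec, transpose_transpose, hr l k hkl, vecMul_zero,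
        zero_dotProduct]
    rw [this]
    refine Finset.sum_le_sum fun k _ => mulVec_dotProduct_self_le ?_ _
    rw [Finset.sum_comm]
    exact hF k
  have hcs : s ^ 2 ≤ (g ⬝ᵥ g) * (z ⬝ᵥ z) := by
    have := Finset.sum_mul_sq_le_sq_mul_sq Finset.univ g z
    rw [← hgz]
    simpa [dotProduct, sq] using this
  have hz : 0 ≤ z ⬝ᵥ z := Finset.sum_nonneg fun i _ => mul_self_nonneg _
  have hs0 : 0 ≤ s := Finset.sum_nonneg fun k _ => Finset.sum_nonneg fun i _ => mul_self_nonneg _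
  rw [h1]
  rcases hs0.eq_or_lt with h | h
  · rwa [← h]
  · refine le_of_mul_le_mul_left ?_ h
    nlinarith [mul_le_mul_of_nonneg_right hgg hz]

end TraceNorm

/-! ### Vertices of the no-signalling polytope with two outputs. -/

section Correlators

variable {mA mB : ℕ}

/-- The behaviour with marginal expectations `A`, `B` and correlators `C`. -/
def ofCorrelators (A : Fin mA → ℝ) (B : Fin mB → ℝ) (C : Fin mA → Fin mB → ℝ) :
    Behaviour mA mB 2 2 :=
  fun a b x y => (1 + outcomeSign a * A x + outcomeSign b * B y +
    outcomeSign a * outcomeSign b * C x y) / 4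

theorem outcomeSign_zero : outcomeSign 0 = 1 := rfl

theorem outcomeSign_one : outcomeSign 1 = -1 := rfl

theorem outcomeSign_sq (a : Fin 2) : outcomeSign a ^ 2 = 1 := by
  fin_cases a <;> simp [outcomeSign]

theorem ofCorrelators_mem_noSignalling {A : Fin mA → ℝ} {B : Fin mB → ℝ}
    {C : Fin mA → Fin mB → ℝ} (h : ∀ a b x y, 0 ≤ ofCorrelators A B C a b x y) :
    ofCorrelators A B C ∈ noSignalling mA mB 2 2 := by
  refine ⟨h, fun x y => ?_, fun a x y y' => ?_, fun b y x x' => ?_⟩ <;>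
  · simp [ofCorrelators, Fin.sum_univ_two, outcomeSign]
    try ring

theorem exists_eq_ofCorrelators {P : Behaviour mA mB 2 2} (hP : P ∈ noSignalling mA mB 2 2) :
    ∃ A B C, P = ofCorrelators A B C := by
  obtain ⟨-, h1, hA, hB⟩ := hP
  rcases Nat.eq_zero_or_pos mA with rfl | hmA
  · exact ⟨0, 0, 0, by ext a b x y; exact x.elim0⟩
  rcases Nat.eq_zero_or_pos mB with rfl | hmB
  · exact ⟨0, 0, 0, by ext a b x y; exact y.elim0⟩
  -- By no-signalling, the marginals can be read off at one reference input of the other party.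
  let x₀ : Fin mA := ⟨0, hmA⟩
  let y₀ : Fin mB := ⟨0, hmB⟩
  refine ⟨fun x => ∑ b, P 0 b x y₀ - ∑ b, P 1 b x y₀,
    fun y => ∑ a, P a 0 x₀ y - ∑ a, P a 1 x₀ y, correlator P, ?_⟩
  ext a b x y
  have h := h1 x y
  have hA0 := hA 0 x y y₀
  have hA1 := hA 1 x y y₀
  have hB0 := hB 0 y x x₀
  have hB1 := hB 1 y x x₀
  simp only [Fin.sum_univ_two, ofCorrelators, correlator] at *
  fin_cases a <;> fin_cases b <;> simp [outcomeSign] <;> linarith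

theorem correlator_ofCorrelators (A : Fin mA → ℝ) (B : Fin mB → ℝ) (C : Fin mA → Fin mB → ℝ)
    (x : Fin mA) (y : Fin mB) : correlator (ofCorrelators A B C) x y = C x y := by
  simp [correlator, ofCorrelators, Fin.sum_univ_two, outcomeSign]
  ring

theorem ofCorrelators_add_smul (A dA : Fin mA → ℝ) (B dB : Fin mB → ℝ)
    (C dC : Fin mA → Fin mB → ℝ) (t : ℝ) (a b : Fin 2) (x : Fin mA) (y : Fin mB) :
    ofCorrelators (A + t • dA) (B + t • dB) (C + t • dC) a b x y = ofCorrelators A B C a b x y +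
      t * ((outcomeSign a * dA x + outcomeSign b * dB y +
        outcomeSign a * outcomeSign b * dC x y) / 4) := by
  simp [ofCorrelators]
  ring

/-- An extreme point is rigid: it admits no perturbation that vanishes wherever it does. -/
theorem eq_zero_of_mem_extremePoints {A dA : Fin mA → ℝ} {B dB : Fin mB → ℝ}
    {C dC : Fin mA → Fin mB → ℝ}
    (hP : ofCorrelators A B C ∈ (noSignalling mA mB 2 2).extremePoints ℝ)
    (hd : ∀ a b x y, ofCorrelators A B C a b x y = 0 →
      outcomeSign a * dA x + outcomeSign b * dB y + outcomeSign a * outcomeSign b * dC x y = 0)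
    (x : Fin mA) (y : Fin mB) : dA x = 0 ∧ dB y = 0 ∧ dC x y = 0 := by
  -- Zero entries stay zero by `hd` and positive ones stay positive for small t. Hence the point is
  -- the midpoint of two behaviours, and extremality makes the perturbation vanish.
  have hev : ∀ᶠ t : ℝ in nhds 0, ∀ a b x y,
      0 ≤ ofCorrelators (A + t • dA) (B + t • dB) (C + t • dC) a b x y := by
    simp only [Filter.eventually_all]
    intro a b x y
    simp only [ofCorrelators_add_smul]
    rcases (hP.1.1 a b x y).eq_or_lt with h | h
    · simp [← h, hd a b x y h.symm]
    · have hc : Filter.Tendsto (fun t : ℝ => ofCorrelators A B C a b x y +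
        t * ((outcomeSign a * dA x + outcomeSign b * dB y +
          outcomeSign a * outcomeSign b * dC x y) / 4)) (nhds 0)
          (nhds (ofCorrelators A B C a b x y)) := by
        have : Continuous (fun t : ℝ => ofCorrelators A B C a b x y +
          t * ((outcomeSign a * dA x + outcomeSign b * dB y +
            outcomeSign a * outcomeSign b * dC x y) / 4)) := by fun_prop
        simpa using this.tendsto 0
      exact (hc.eventually (lt_mem_nhds h)).mono fun _ h => h.le
  obtain ⟨ε, hε, hball⟩ := Metric.eventually_nhds_iff.1 hev
  have hplus := ofCorrelators_mem_noSignalling (hball (y := ε / 2)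
    (by rw [Real.dist_eq, sub_zero, abs_of_pos (by linarith)]; linarith))
  have hminus := ofCorrelators_mem_noSignalling (hball (y := -(ε / 2))
    (by rw [Real.dist_eq, sub_zero, abs_neg, abs_of_pos (by linarith)]; linarith))
  have hmid : ofCorrelators A B C ∈ openSegment ℝ
      (ofCorrelators (A + (ε / 2) • dA) (B + (ε / 2) • dB) (C + (ε / 2) • dC))
      (ofCorrelators (A + (-(ε / 2)) • dA) (B + (-(ε / 2)) • dB) (C + (-(ε / 2)) • dC)) := by
    refine ⟨1 / 2, 1 / 2, by norm_num, by norm_num, by norm_num, ?_⟩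
    ext a b x y
    simp only [Pi.add_apply, Pi.smul_apply, smul_eq_mul, ofCorrelators_add_smul]
    ring
  have heq := hP.2 hplus hminus hmid
  have hzero : ∀ a b, outcomeSign a * dA x + outcomeSign b * dB y +
      outcomeSign a * outcomeSign b * dC x y = 0 := fun a b => by
    have := congrFun (congrFun (congrFun (congrFun heq a) b) x) y
    rw [ofCorrelators_add_smul] at this
    have h2 : ε / 2 * ((outcomeSign a * dA x + outcomeSign b * dB y +
      outcomeSign a * outcomeSign b * dC x y) / 4) = 0 := by linarith
    rcases mul_eq_zero.1 h2 with h | h <;> linarith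
  have h00 := hzero 0 0
  have h01 := hzero 0 1
  have h10 := hzero 1 0
  have h11 := hzero 1 1
  simp [outcomeSign] at h00 h01 h10 h11
  exact ⟨by linarith, by linarith, by linarith⟩

/-- At two zeros of a behaviour, the perturbations of its correlator that preserve the zero when
each marginal `t` is shifted in the direction `t - t ^ 3` agree. -/
theorem cubic_perturbation_eq {A : Fin mA → ℝ} {B : Fin mB → ℝ} {C : Fin mA → Fin mB → ℝ}
    {x : Fin mA} {y : Fin mB} {a b a' b' : Fin 2} (h : ofCorrelators A B C a b x y = 0)
    (h' : ofCorrelators A B C a' b' x y = 0) :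
    outcomeSign b * (A x - A x ^ 3) + outcomeSign a * (B y - B y ^ 3) =
      outcomeSign b' * (A x - A x ^ 3) + outcomeSign a' * (B y - B y ^ 3) := by
  simp only [ofCorrelators] at h h'
  -- Two distinct zeros force A = ±B, or A = ±1, or B = ±1. The claim follows because t - t³ is odd
  -- and vanishes at ±1.
  fin_cases a <;> fin_cases b <;> fin_cases a' <;> fin_cases b' <;>
    simp [outcomeSign] at h h' ⊢ <;>
    first
      | done
      | (have e : A x = B y := by linarith
         rw [e]; ring)
      | (have e : A x = -B y := by linarith
         rw [e]; ring)
      | (have e : A x = 1 := by linarith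
         rw [e]; ring)
      | (have e : A x = -1 := by linarith
         rw [e]; ring)
      | (have e : B y = 1 := by linarith
         rw [e]; ring)
      | (have e : B y = -1 := by linarith
         rw [e]; ring)

/-- Shifting every marginal t along t - t³ is an admissible perturbation. At each input pair with a
zero entry, `dC` is chosen to preserve one zero, and `cubic_perturbation_eq` shows that it preserves
all. Rigidity gives t = t³. -/
theorem marginals_of_mem_extremePoints {A : Fin mA → ℝ} {B : Fin mB → ℝ}
    {C : Fin mA → Fin mB → ℝ}
    (hP : ofCorrelators A B C ∈ (noSignalling mA mB 2 2).extremePoints ℝ)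
    (x : Fin mA) (y : Fin mB) : A x ^ 3 = A x ∧ B y ^ 3 = B y := by
  classical
  let Z : Fin mA → Fin mB → Prop := fun x y => ∃ p : Fin 2 × Fin 2,
    ofCorrelators A B C p.1 p.2 x y = 0
  let dA : Fin mA → ℝ := fun x => A x - A x ^ 3
  let dB : Fin mB → ℝ := fun y => B y - B y ^ 3
  let dC : Fin mA → Fin mB → ℝ := fun x y => if h : Z x y then
    -(outcomeSign h.choose.2 * dA x + outcomeSign h.choose.1 * dB y) else 0
  have key := eq_zero_of_mem_extremePoints (dA := dA) (dB := dB) (dC := dC) hP (by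
    intro a b x y h
    have hZ : Z x y := ⟨(a, b), h⟩
    have h1 := cubic_perturbation_eq h hZ.choose_spec
    simp only [dC, dif_pos hZ]
    linear_combination outcomeSign a * outcomeSign b * h1 -
      outcomeSign a * dA x * outcomeSign_sq b - outcomeSign b * dB y * outcomeSign_sq a) x y
  exact ⟨by linarith [key.1], by linarith [key.2.1]⟩

/-- Correlators between uniform inputs can be shifted by 1 - C², which vanishes wherever such a pair
has a zero entry. -/
theorem correlator_sq_of_mem_extremePoints {A : Fin mA → ℝ} {B : Fin mB → ℝ}
    {C : Fin mA → Fin mB → ℝ}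
    (hP : ofCorrelators A B C ∈ (noSignalling mA mB 2 2).extremePoints ℝ)
    {x : Fin mA} {y : Fin mB} (hA : A x = 0) (hB : B y = 0) : C x y ^ 2 = 1 := by
  classical
  have key := eq_zero_of_mem_extremePoints (dA := 0) (dB := 0)
    (dC := fun x y => if A x = 0 ∧ B y = 0 then 1 - C x y ^ 2 else 0) hP (by
    intro a b x y h
    split_ifs with hAB
    · have h1 : outcomeSign a * outcomeSign b * C x y = -1 := by
        simp only [ofCorrelators, hAB] at h
        linarith
      have h2 : C x y ^ 2 = 1 := by
        have := congrArg (· ^ 2) h1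
        simpa [mul_pow, outcomeSign_sq] using this
      simp [h2]
    · simp) x y
  have h := key.2.2
  rw [if_pos ⟨hA, hB⟩] at h
  linarith

theorem correlator_eq_mul_of_marginal_sq {A : Fin mA → ℝ} {B : Fin mB → ℝ}
    {C : Fin mA → Fin mB → ℝ} (hP : ofCorrelators A B C ∈ noSignalling mA mB 2 2)
    {x : Fin mA} {y : Fin mB} (h : A x ^ 2 = 1 ∨ B y ^ 2 = 1) : C x y = A x * B y := by
  have p00 := hP.1 0 0 x y
  have p01 := hP.1 0 1 x y
  have p10 := hP.1 1 0 x y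
  have p11 := hP.1 1 1 x y
  simp [ofCorrelators, outcomeSign] at p00 p01 p10 p11
  rcases h with h | h <;> rcases sq_eq_one_iff.1 h with h | h <;> rw [h] <;> linarith

theorem sum_ofCorrelators_right (A : Fin mA → ℝ) (B : Fin mB → ℝ) (C : Fin mA → Fin mB → ℝ)
    (a : Fin 2) (x : Fin mA) (y : Fin mB) :
    ∑ b, ofCorrelators A B C a b x y = (1 + outcomeSign a * A x) / 2 := by
  simp [ofCorrelators, Fin.sum_univ_two, outcomeSign]
  ring

theorem sum_ofCorrelators_left (A : Fin mA → ℝ) (B : Fin mB → ℝ) (C : Fin mA → Fin mB → ℝ)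
    (b : Fin 2) (x : Fin mA) (y : Fin mB) :
    ∑ a, ofCorrelators A B C a b x y = (1 + outcomeSign b * B y) / 2 := by
  simp [ofCorrelators, Fin.sum_univ_two, outcomeSign]
  ring

theorem exists_outcomeSign_mul_eq_one_iff {t : ℝ} : (∃ a, outcomeSign a * t = 1) ↔ t ^ 2 = 1 := by
  rw [Fin.exists_fin_two, sq_eq_one_iff]
  simp [outcomeSign, neg_eq_iff_eq_neg]

theorem ncard_sq_eq_one {ι : Type*} [Fintype ι] {v : ι → ℝ} (hv : ∀ i, v i = 0 ∨ v i ^ 2 = 1) :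
    ({i | v i ^ 2 = 1}.ncard : ℝ) = ∑ i, v i ^ 2 := by
  classical
  rw [Set.ncard_eq_toFinset_card', Finset.card_eq_sum_ones, Set.toFinset_ofPred,
    Finset.sum_filter]
  push_cast
  refine Finset.sum_congr rfl fun i _ => ?_
  rcases hv i with h | h <;> simp [h]

/-- The input `y₀` is needed because the condition ∀ y in the count is vacuous when the other party
has no inputs. -/
theorem numDeterministicA_ofCorrelators {A : Fin mA → ℝ} (hA : ∀ x, A x = 0 ∨ A x ^ 2 = 1)
    (B : Fin mB → ℝ) (C : Fin mA → Fin mB → ℝ) (y₀ : Fin mB) :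
    (numDeterministicA (ofCorrelators A B C) : ℝ) = ∑ x, A x ^ 2 := by
  rw [← ncard_sq_eq_one hA, numDeterministicA]
  congr 3
  ext x
  rw [← exists_outcomeSign_mul_eq_one_iff]
  refine exists_congr fun a => ?_
  simp only [sum_ofCorrelators_right]
  exact ⟨fun h => by linarith [h y₀], fun h _ => by linarith⟩

theorem numDeterministicB_ofCorrelators (A : Fin mA → ℝ) {B : Fin mB → ℝ}
    (hB : ∀ y, B y = 0 ∨ B y ^ 2 = 1) (C : Fin mA → Fin mB → ℝ) (x₀ : Fin mA) :
    (numDeterministicB (ofCorrelators A B C) : ℝ) = ∑ y, B y ^ 2 := by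
  rw [← ncard_sq_eq_one hB, numDeterministicB]
  congr 3
  ext y
  rw [← exists_outcomeSign_mul_eq_one_iff]
  refine exists_congr fun b => ?_
  simp only [sum_ofCorrelators_left]
  exact ⟨fun h => by linarith [h x₀], fun h _ => by linarith⟩

theorem localDeterministic_eq_ofCorrelators (f : Fin mA → Fin 2) (g : Fin mB → Fin 2) :
    localDeterministic f g = ofCorrelators (fun x => outcomeSign (f x))
      (fun y => outcomeSign (g y)) (fun x y => outcomeSign (f x) * outcomeSign (g y)) := by
  have h : ∀ a b : Fin 2, (if a = b then (1 : ℝ) else 0) =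
      (1 + outcomeSign a * outcomeSign b) / 2 := by
    intro a b
    fin_cases a <;> fin_cases b <;> simp [outcomeSign]
  ext a b x y
  rw [localDeterministic, h, h, ofCorrelators]
  ring

theorem ofCorrelators_mul_mem_localSet {α : Fin mA → ℝ} {β : Fin mB → ℝ}
    (hα : ∀ x, α x ^ 2 = 1) (hβ : ∀ y, β y ^ 2 = 1) :
    ofCorrelators α β (fun x y => α x * β y) ∈ localSet mA mB 2 2 := by
  have hs : ∀ {t : ℝ}, t ^ 2 = 1 → ∃ a, outcomeSign a = t := fun {t} ht => by
    rw [Fin.exists_fin_two]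
    rcases sq_eq_one_iff.1 ht with h | h <;> simp [outcomeSign, h]
  choose f hf using fun x => hs (hα x)
  choose g hg using fun y => hs (hβ y)
  refine subset_convexHull ℝ _ ⟨f, g, ?_⟩
  simp only [localDeterministic_eq_ofCorrelators, hf, hg]

/-- A behaviour whose correlators factorize on the inputs with uniform marginals, all other inputs
being deterministic, is local. -/
theorem mem_localSet_of_factorization {A : Fin mA → ℝ} {B : Fin mB → ℝ}
    {C : Fin mA → Fin mB → ℝ} (hA : ∀ x, A x = 0 ∨ A x ^ 2 = 1) (hB : ∀ y, B y = 0 ∨ B y ^ 2 = 1)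
    (hC : ∀ x y, A x ^ 2 = 1 ∨ B y ^ 2 = 1 → C x y = A x * B y) {α : Fin mA → ℝ}
    {β : Fin mB → ℝ} (hα : ∀ x, A x = 0 → α x ^ 2 = 1) (hβ : ∀ y, B y = 0 → β y ^ 2 = 1)
    (hαβ : ∀ x y, A x = 0 → B y = 0 → C x y = α x * β y) :
    ofCorrelators A B C ∈ localSet mA mB 2 2 := by
  classical
  -- Flipping the signs of α and β together gives two deterministic behaviours. In their equal
  -- mixture the marginals of the uniform inputs cancel while the products α_x β_y survive.
  have hmem : ∀ s : ℝ, s ^ 2 = 1 → ofCorrelators (fun x => if A x = 0 then s * α x else A x)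
      (fun y => if B y = 0 then s * β y else B y) (fun x y =>
        (if A x = 0 then s * α x else A x) * (if B y = 0 then s * β y else B y)) ∈
      localSet mA mB 2 2 := fun s hs => by
    refine ofCorrelators_mul_mem_localSet (fun x => ?_) fun y => ?_
    · split_ifs with h
      · rw [mul_pow, hs, hα x h, one_mul]
      · exact (hA x).resolve_left h
    · split_ifs with h
      · rw [mul_pow, hs, hβ y h, one_mul]
      · exact (hB y).resolve_left h
  have hconv := (convex_convexHull ℝ _) (hmem 1 (by norm_num)) (hmem (-1) (by norm_num))
    (show (0 : ℝ) ≤ 1 / 2 by norm_num) (show (0 : ℝ) ≤ 1 / 2 by norm_num) (by norm_num)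
  convert! hconv using 1
  ext a b x y
  simp only [ofCorrelators, Pi.add_apply, Pi.smul_apply, smul_eq_mul]
  by_cases hx : A x = 0 <;> by_cases hy : B y = 0
  · rw [if_pos hx, if_pos hx, if_pos hy, if_pos hy, hαβ x y hx hy, hx, hy]
    ring
  · rw [if_pos hx, if_pos hx, if_neg hy, if_neg hy, hC x y (.inr ((hB y).resolve_left hy)), hx]
    ring
  · rw [if_neg hx, if_neg hx, if_pos hy, if_pos hy, hC x y (.inl ((hA x).resolve_left hx)), hy]
    ring
  · rw [if_neg hx, if_neg hx, if_neg hy, if_neg hy, hC x y (.inl ((hA x).resolve_left hx))]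
    ring

/-- Two inputs of each party on which a behaviour is the Popescu-Rohrlich box: uniform marginals,
and perfect correlations that do not factorize. -/
structure IsCHSHBlock (A : Fin mA → ℝ) (B : Fin mB → ℝ) (C : Fin mA → Fin mB → ℝ)
    (x₀ x₁ : Fin mA) (y₀ y₁ : Fin mB) : Prop where
  left₀ : A x₀ = 0
  left₁ : A x₁ = 0
  right₀ : B y₀ = 0
  right₁ : B y₁ = 0
  frustrated : C x₀ y₀ * C x₀ y₁ = -(C x₁ y₀ * C x₁ y₁)

/-- Without a frustrated block, any two rows of the sign matrix on the uniform inputs agree up to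
sign. The matrix then factorizes, and the behaviour is local. -/
theorem exists_isCHSHBlock {A : Fin mA → ℝ} {B : Fin mB → ℝ}
    {C : Fin mA → Fin mB → ℝ} (hA : ∀ x, A x = 0 ∨ A x ^ 2 = 1) (hB : ∀ y, B y = 0 ∨ B y ^ 2 = 1)
    (hC : ∀ x y, A x ^ 2 = 1 ∨ B y ^ 2 = 1 → C x y = A x * B y)
    (hC1 : ∀ x y, A x = 0 → B y = 0 → C x y ^ 2 = 1)
    (hloc : ofCorrelators A B C ∉ localSet mA mB 2 2) :
    ∃ x₀ x₁ y₀ y₁, IsCHSHBlock A B C x₀ x₁ y₀ y₁ := by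
  by_contra! hcon
  have hfact : ∀ x₀ x₁ y₀ y₁, A x₀ = 0 → A x₁ = 0 → B y₀ = 0 → B y₁ = 0 →
      C x₀ y₀ * C x₀ y₁ = C x₁ y₀ * C x₁ y₁ := fun x₀ x₁ y₀ y₁ hx₀ hx₁ hy₀ hy₁ => by
    have hsq : (C x₀ y₀ * C x₀ y₁) ^ 2 = (C x₁ y₀ * C x₁ y₁) ^ 2 := by
      simp only [mul_pow, hC1 _ _ hx₀ hy₀, hC1 _ _ hx₀ hy₁, hC1 _ _ hx₁ hy₀, hC1 _ _ hx₁ hy₁]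
    exact (sq_eq_sq_iff_eq_or_eq_neg.1 hsq).resolve_right fun h =>
      hcon x₀ x₁ y₀ y₁ ⟨hx₀, hx₁, hy₀, hy₁, h⟩
  by_cases hx : ∃ x, A x = 0
  · by_cases hy : ∃ y, B y = 0
    · obtain ⟨x₀, hx₀⟩ := hx
      obtain ⟨y₀, hy₀⟩ := hy
      refine hloc (mem_localSet_of_factorization hA hB hC (α := fun x => C x y₀)
        (β := fun y => C x₀ y₀ * C x₀ y) (fun x h => hC1 x y₀ h hy₀) (fun y h => ?_)
        fun x y h h' => ?_)
      · rw [mul_pow, hC1 _ _ hx₀ hy₀, hC1 _ _ hx₀ h, one_mul]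
      · rw [hfact x₀ x y₀ y hx₀ h hy₀ h', ← mul_assoc, ← sq, hC1 x y₀ h hy₀, one_mul]
    · push Not at hy
      -- If one party has no uniform input, there is nothing to factorize and any signs serve.
      exact hloc (mem_localSet_of_factorization hA hB hC (α := 1) (β := 1) (by simp) (by simp)
        fun x y _ h => absurd h (hy y))
  · push Not at hx
    exact hloc (mem_localSet_of_factorization hA hB hC (α := 1) (β := 1) (by simp) (by simp)
      fun x y h _ => absurd h (hx x))

/-- The structure of the nonlocal vertices of the no-signalling polytope with two outputs. -/
theorem IsPRBox.exists_ofCorrelators {m : ℕ} {P : Behaviour m m 2 2} (hP : IsPRBox P) :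
    ∃ (A B : Fin m → ℝ) (C : Fin m → Fin m → ℝ), P = ofCorrelators A B C ∧
      (∀ x, A x = 0 ∨ A x ^ 2 = 1) ∧ (∀ y, B y = 0 ∨ B y ^ 2 = 1) ∧
      (∀ x y, A x ^ 2 = 1 ∨ B y ^ 2 = 1 → C x y = A x * B y) ∧
      (∀ x y, A x = 0 → B y = 0 → C x y ^ 2 = 1) ∧
      ∃ x₀ x₁ y₀ y₁, IsCHSHBlock A B C x₀ x₁ y₀ y₁ := by
  obtain ⟨hext, hloc⟩ := hP
  obtain ⟨A, B, C, rfl⟩ := exists_eq_ofCorrelators hext.1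
  have hcube : ∀ {t : ℝ}, t ^ 3 = t → t = 0 ∨ t ^ 2 = 1 := fun {t} h => by
    rcases mul_eq_zero.1 (show t * (t ^ 2 - 1) = 0 by linear_combination h) with h | h
    · exact .inl h
    · exact .inr (by linarith)
  have hA : ∀ x, A x = 0 ∨ A x ^ 2 = 1 := fun x =>
    hcube (marginals_of_mem_extremePoints hext x x).1
  have hB : ∀ y, B y = 0 ∨ B y ^ 2 = 1 := fun y =>
    hcube (marginals_of_mem_extremePoints hext y y).2
  have hC : ∀ x y, A x ^ 2 = 1 ∨ B y ^ 2 = 1 → C x y = A x * B y := fun x y h =>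
    correlator_eq_mul_of_marginal_sq hext.1 h
  have hC1 : ∀ x y, A x = 0 → B y = 0 → C x y ^ 2 = 1 := fun x y h h' =>
    correlator_sq_of_mem_extremePoints hext h h'
  exact ⟨A, B, C, rfl, hA, hB, hC, hC1, exists_isCHSHBlock hA hB hC hC1 hloc⟩

end Correlators

/-! ### Pieces of the dual witnesses: orthogonality, Frobenius norms, values on a behaviour. -/

section Witness

open Matrix

/-- Matrices with mutually orthogonal ranges and mutually orthogonal coranges. -/
def IsBiorthogonal {m n : Type*} [Fintype m] [Fintype n] (M N : Matrix m n ℝ) : Prop :=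
  Mᵀ * N = 0 ∧ M * Nᵀ = 0

theorem IsBiorthogonal.symm {m n : Type*} [Fintype m] [Fintype n] {M N : Matrix m n ℝ}
    (h : IsBiorthogonal M N) : IsBiorthogonal N M :=
  ⟨by simpa using congrArg transpose h.1, by simpa using congrArg transpose h.2⟩

theorem sum_le_traceNorm {m n ι : Type*} [Fintype m] [Fintype n] [DecidableEq n] [Fintype ι]
    (M : Matrix m n ℝ) (W : ι → Matrix m n ℝ) (hF : ∀ k, ∑ i, ∑ j, W k i j ^ 2 ≤ 1)
    (hW : ∀ k l, k ≠ l → IsBiorthogonal (W k) (W l)) :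
    ∑ k, ∑ i, ∑ j, W k i j * M i j ≤ traceNorm M := by
  refine le_of_eq_of_le ?_ (sum_mul_le_traceNorm M (∑ k, W k)
    (sum_mulVec_dotProduct_self_le W hF (fun k l h => (hW k l h).1) fun k l h => (hW k l h).2))
  simp only [Matrix.sum_apply, Finset.sum_mul]
  rw [Finset.sum_comm]
  refine Finset.sum_congr rfl fun i _ => Finset.sum_comm

variable {m n p : Type*}

/-- The matrix acting as `K` on the antisymmetric vectors `(|x0⟩ - |x1⟩)/√2`. -/
def correlationMatrix (K : Matrix m n ℝ) : Matrix (m × Fin 2) (n × Fin 2) ℝ :=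
  of fun r c => outcomeSign r.2 * outcomeSign c.2 * K r.1 c.1 / 2

/-- The rank-one matrix with entries `c (1 + a A_x) (1 + b B_y) / 2`. -/
def marginalMatrix (c : ℝ) (A : m → ℝ) (B : n → ℝ) : Matrix (m × Fin 2) (n × Fin 2) ℝ :=
  of fun r s => c * ((1 + outcomeSign r.2 * A r.1) * (1 + outcomeSign s.2 * B s.1)) / 2

theorem correlationMatrix_transpose (K : Matrix m n ℝ) :
    (correlationMatrix K)ᵀ = correlationMatrix Kᵀ := by
  ext r c
  simp [correlationMatrix, mul_comm]

theorem marginalMatrix_transpose (c : ℝ) (A : m → ℝ) (B : n → ℝ) :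
    (marginalMatrix c A B)ᵀ = marginalMatrix c B A := by
  ext r s
  simp [marginalMatrix, mul_comm]

theorem correlationMatrix_zero : correlationMatrix (0 : Matrix m n ℝ) = 0 := by
  ext r c
  simp [correlationMatrix]

/-- `correlationMatrix K` is K ⊗ q, where q is the projection onto (1, -1)/√2, and q² = q. -/
theorem correlationMatrix_mul [Fintype n] (K : Matrix m n ℝ) (L : Matrix n p ℝ) :
    correlationMatrix K * correlationMatrix L = correlationMatrix (K * L) := by
  ext r c
  simp only [mul_apply, correlationMatrix, of_apply, Fintype.sum_prod_type, Fin.sum_univ_two,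
    Finset.mul_sum, Finset.sum_div]
  refine Finset.sum_congr rfl fun y _ => ?_
  simp [outcomeSign]
  ring

/-- Summing b(1 + bB_y) over b = ±1 leaves 2B_y, which vanishes on the support of K. -/
theorem marginalMatrix_mul_correlationMatrix [Fintype n] (c : ℝ) (A : m → ℝ) {B : n → ℝ}
    {K : Matrix n p ℝ} (h : ∀ y z, B y * K y z = 0) :
    marginalMatrix c A B * correlationMatrix K = 0 := by
  ext r s
  simp only [mul_apply, correlationMatrix, marginalMatrix, of_apply, Fintype.sum_prod_type,
    Fin.sum_univ_two, Matrix.zero_apply]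
  refine Finset.sum_eq_zero fun y _ => ?_
  simp only [outcomeSign_zero, outcomeSign_one]
  linear_combination c * (1 + outcomeSign r.2 * A r.1) * outcomeSign s.2 / 2 * h y s.1

theorem isBiorthogonal_correlationMatrix [Fintype m] [Fintype n] {K L : Matrix m n ℝ}
    (h : IsBiorthogonal K L) : IsBiorthogonal (correlationMatrix K) (correlationMatrix L) := by
  constructor <;>
  simp only [correlationMatrix_transpose, correlationMatrix_mul, h.1, h.2, correlationMatrix_zero]

theorem isBiorthogonal_marginalMatrix_correlationMatrix [Fintype m] [Fintype n] (c : ℝ)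
    {A : m → ℝ} {B : n → ℝ} {K : Matrix m n ℝ} (hA : ∀ x y, A x * K x y = 0)
    (hB : ∀ x y, B y * K x y = 0) :
    IsBiorthogonal (marginalMatrix c A B) (correlationMatrix K) := by
  constructor
  · rw [marginalMatrix_transpose, marginalMatrix_mul_correlationMatrix c B hA]
  · rw [correlationMatrix_transpose,
      marginalMatrix_mul_correlationMatrix c A fun y x => by rw [transpose_apply, hB]]

theorem sum_correlationMatrix_sq [Fintype m] [Fintype n] (K : Matrix m n ℝ) :
    ∑ r, ∑ s, correlationMatrix K r s ^ 2 = ∑ x, ∑ y, K x y ^ 2 := by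
  simp only [Fintype.sum_prod_type]
  refine Finset.sum_congr rfl fun x _ => ?_
  simp only [Fin.sum_univ_two, ← Finset.sum_add_distrib]
  refine Finset.sum_congr rfl fun y _ => ?_
  simp [correlationMatrix, outcomeSign]
  ring

theorem sum_marginalMatrix_sq [Fintype m] [Fintype n] (c : ℝ) (A : m → ℝ) (B : n → ℝ) :
    ∑ r, ∑ s, marginalMatrix c A B r s ^ 2 =
      c ^ 2 * ((∑ x, (1 + A x ^ 2)) * ∑ y, (1 + B y ^ 2)) := by
  rw [Finset.sum_mul_sum, Finset.mul_sum, Fintype.sum_prod_type]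
  refine Finset.sum_congr rfl fun x _ => ?_
  rw [Finset.mul_sum]
  simp only [Fintype.sum_prod_type, Fin.sum_univ_two, ← Finset.sum_add_distrib]
  refine Finset.sum_congr rfl fun y _ => ?_
  simp [marginalMatrix, outcomeSign]
  ring

theorem sum_correlationMatrix_mul {mA mB : ℕ} (K : Matrix (Fin mA) (Fin mB) ℝ)
    (P : Behaviour mA mB 2 2) :
    ∑ r, ∑ s, correlationMatrix K r s * P.toMatrix r s =
      (∑ x, ∑ y, K x y * correlator P x y) / 2 := by
  rw [Finset.sum_div, Fintype.sum_prod_type]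
  refine Finset.sum_congr rfl fun x _ => ?_
  rw [Finset.sum_div]
  simp only [Fintype.sum_prod_type, Fin.sum_univ_two, ← Finset.sum_add_distrib]
  refine Finset.sum_congr rfl fun y _ => ?_
  simp [correlationMatrix, outcomeSign, correlator, Behaviour.toMatrix]
  ring

/-- Each input pair contributes c/2 times 1 + A² + B² + ABC, and `h` turns this into the product (1
+ A²)(1 + B²). -/
theorem sum_marginalMatrix_mul {mA mB : ℕ} (c : ℝ) {A : Fin mA → ℝ} {B : Fin mB → ℝ}
    {C : Fin mA → Fin mB → ℝ} (h : ∀ x y, A x * B y * C x y = A x ^ 2 * B y ^ 2) :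
    ∑ r, ∑ s, marginalMatrix c A B r s * (ofCorrelators A B C).toMatrix r s =
      c * ((∑ x, (1 + A x ^ 2)) * ∑ y, (1 + B y ^ 2)) / 2 := by
  rw [Finset.sum_mul_sum, Finset.mul_sum, Finset.sum_div, Fintype.sum_prod_type]
  refine Finset.sum_congr rfl fun x _ => ?_
  rw [Finset.mul_sum, Finset.sum_div]
  simp only [Fintype.sum_prod_type, Fin.sum_univ_two, ← Finset.sum_add_distrib]
  refine Finset.sum_congr rfl fun y _ => ?_
  simp [marginalMatrix, outcomeSign, ofCorrelators, Behaviour.toMatrix]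
  linear_combination c / 2 * h x y

section Block

variable [DecidableEq m] [DecidableEq n]

/-- The matrix `c • C` restricted to the rows in `S` and the columns in `T`. -/
def block (S : Finset m) (T : Finset n) (c : ℝ) (C : m → n → ℝ) : Matrix m n ℝ :=
  of fun x y => if x ∈ S ∧ y ∈ T then c * C x y else 0

theorem mul_block_eq_zero {S : Finset m} {T : Finset n} {v : m → n → ℝ} (c : ℝ) (C : m → n → ℝ)
    (hv : ∀ x ∈ S, ∀ y ∈ T, v x y = 0) (x : m) (y : n) : v x y * block S T c C x y = 0 := by
  rw [block, of_apply]
  split_ifs with h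
  · rw [hv x h.1 y h.2, zero_mul]
  · rw [mul_zero]

theorem sum_ite_mem_and [Fintype m] [Fintype n] (S : Finset m) (T : Finset n) (f : m → n → ℝ) :
    ∑ x, ∑ y, (if x ∈ S ∧ y ∈ T then f x y else 0) = ∑ x ∈ S, ∑ y ∈ T, f x y := by
  simp [ite_and, Finset.sum_ite_mem, Finset.sum_ite_irrel]

theorem sum_block_mul [Fintype m] [Fintype n] (S : Finset m) (T : Finset n) (c : ℝ) (C D : m → n → ℝ) :
    ∑ x, ∑ y, block S T c C x y * D x y = ∑ x ∈ S, ∑ y ∈ T, c * C x y * D x y := by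
  simp only [block, of_apply, ite_mul, zero_mul, sum_ite_mem_and]

theorem sum_block_mul_self [Fintype m] [Fintype n] {S : Finset m} {T : Finset n} (c : ℝ) {C : m → n → ℝ}
    (hC : ∀ x ∈ S, ∀ y ∈ T, C x y ^ 2 = 1) :
    ∑ x, ∑ y, block S T c C x y * C x y = c * (S.card * T.card) := by
  rw [sum_block_mul, Finset.sum_congr rfl fun x hx => Finset.sum_congr rfl fun y hy =>
    show c * C x y * C x y = c by rw [mul_assoc, ← sq, hC x hx y hy, mul_one]]
  simp
  ring

theorem sum_block_sq [Fintype m] [Fintype n] {S : Finset m} {T : Finset n} (c : ℝ) {C : m → n → ℝ}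
    (hC : ∀ x ∈ S, ∀ y ∈ T, C x y ^ 2 = 1) :
    ∑ x, ∑ y, block S T c C x y ^ 2 = c ^ 2 * (S.card * T.card) := by
  simp only [block, of_apply, ite_pow, ne_eq, OfNat.ofNat_ne_zero, not_false_eq_true, zero_pow,
    sum_ite_mem_and]
  rw [Finset.sum_congr rfl fun x hx => Finset.sum_congr rfl fun y hy =>
    show (c * C x y) ^ 2 = c ^ 2 by rw [mul_pow, hC x hx y hy, mul_one]]
  simp
  ring

theorem block_transpose_mul_block [Fintype m] {S S' : Finset m} (h : Disjoint S S') (T T' : Finset n)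
    (c c' : ℝ) (C C' : m → n → ℝ) : (block S T c C)ᵀ * block S' T' c' C' = 0 := by
  ext y y'
  rw [mul_apply]
  refine Finset.sum_eq_zero fun x _ => ?_
  simp only [block, transpose_apply, of_apply]
  have : x ∈ S → x ∉ S' := fun hx => Finset.disjoint_left.1 h hx
  split_ifs <;> simp_all

theorem block_mul_block_transpose [Fintype n] (S S' : Finset m) {T T' : Finset n} (h : Disjoint T T')
    (c c' : ℝ) (C C' : m → n → ℝ) : block S T c C * (block S' T' c' C')ᵀ = 0 := by
  ext x x'
  rw [mul_apply]
  refine Finset.sum_eq_zero fun y _ => ?_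
  simp only [block, transpose_apply, of_apply]
  have : y ∈ T → y ∉ T' := fun hy => Finset.disjoint_left.1 h hy
  split_ifs <;> simp_all

theorem isBiorthogonal_block [Fintype m] [Fintype n] {S S' : Finset m} {T T' : Finset n} (hS : Disjoint S S')
    (hT : Disjoint T T') (c c' : ℝ) (C C' : m → n → ℝ) :
    IsBiorthogonal (block S T c C) (block S' T' c' C') :=
  ⟨block_transpose_mul_block hS T T' c c' C C', block_mul_block_transpose S S' hT c c' C C'⟩

end Block

/-! ### The frustrated block and the two trace-norm bounds. -/

section CHSH

variable {mA mB : ℕ} {A : Fin mA → ℝ} {B : Fin mB → ℝ} {C : Fin mA → Fin mB → ℝ}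
  {x₀ x₁ : Fin mA} {y₀ y₁ : Fin mB}

theorem IsCHSHBlock.rows_ne (h : IsCHSHBlock A B C x₀ x₁ y₀ y₁)
    (hC : ∀ x y, A x = 0 → B y = 0 → C x y ^ 2 = 1) : x₀ ≠ x₁ := by
  rintro rfl
  have h1 := h.frustrated
  have h2 : (C x₀ y₀ * C x₀ y₁) ^ 2 = 1 := by
    rw [mul_pow, hC _ _ h.left₀ h.right₀, hC _ _ h.left₀ h.right₁, one_mul]
  nlinarith

theorem IsCHSHBlock.columns_ne (h : IsCHSHBlock A B C x₀ x₁ y₀ y₁)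
    (hC : ∀ x y, A x = 0 → B y = 0 → C x y ^ 2 = 1) : y₀ ≠ y₁ := by
  rintro rfl
  have h1 := h.frustrated
  nlinarith [hC _ _ h.left₀ h.right₀, hC _ _ h.left₁ h.right₀]

/-- Frustration says exactly that the two sign rows of the block are orthogonal, so they can be
separate pieces of a witness although they share their columns. -/
theorem IsCHSHBlock.isBiorthogonal_rows (h : IsCHSHBlock A B C x₀ x₁ y₀ y₁)
    (hC : ∀ x y, A x = 0 → B y = 0 → C x y ^ 2 = 1) (c : ℝ) :
    IsBiorthogonal (block {x₀} {y₀, y₁} c C) (block {x₁} {y₀, y₁} c C) := by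
  refine ⟨block_transpose_mul_block (by simpa using h.rows_ne hC) _ _ _ _ _ _, ?_⟩
  have horth : C x₀ y₀ * C x₁ y₀ + C x₀ y₁ * C x₁ y₁ = 0 := by
    linear_combination C x₀ y₁ * C x₁ y₀ * h.frustrated -
      C x₀ y₀ * C x₁ y₀ * hC _ _ h.left₀ h.right₁ - C x₀ y₁ * C x₁ y₁ * hC _ _ h.left₁ h.right₀
  ext x x'
  rw [mul_apply]
  by_cases hx : x = x₀
  · by_cases hx' : x' = x₁
    · have hterm : ∀ y, block {x₀} {y₀, y₁} c C x y * (block {x₁} {y₀, y₁} c C)ᵀ y x' =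
          if y ∈ ({y₀, y₁} : Finset (Fin mB)) then c ^ 2 * (C x₀ y * C x₁ y) else 0 := by
        intro y
        simp only [block, transpose_apply, of_apply, hx, hx', Finset.mem_singleton, true_and]
        split_ifs
        · ring
        · ring
      simp only [hterm, Finset.sum_ite_mem, Finset.univ_inter]
      rw [Finset.sum_pair (h.columns_ne hC), ← mul_add, horth, mul_zero, Matrix.zero_apply]
    · exact Finset.sum_eq_zero fun y _ => by simp [block, hx']
  · exact Finset.sum_eq_zero fun y _ => by simp [block, hx]

theorem inv_sqrt_two_sq : ((√2)⁻¹) ^ 2 = (2⁻¹ : ℝ) := by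
  rw [inv_pow, Real.sq_sqrt (by norm_num)]

theorem IsCHSHBlock.sum_row_sq (h : IsCHSHBlock A B C x₀ x₁ y₀ y₁)
    (hC : ∀ x y, A x = 0 → B y = 0 → C x y ^ 2 = 1) {x : Fin mA} (hx : A x = 0) :
    ∑ r, ∑ s, correlationMatrix (block {x} {y₀, y₁} (√2)⁻¹ C) r s ^ 2 = 1 := by
  rw [sum_correlationMatrix_sq, sum_block_sq, Finset.card_pair (h.columns_ne hC),
    inv_sqrt_two_sq]
  · simp
  · simp [-sq_eq_one_iff, hC _ _ hx h.right₀, hC _ _ hx h.right₁]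

theorem IsCHSHBlock.sum_row_mul (h : IsCHSHBlock A B C x₀ x₁ y₀ y₁)
    (hC : ∀ x y, A x = 0 → B y = 0 → C x y ^ 2 = 1) {x : Fin mA} (hx : A x = 0) :
    ∑ r, ∑ s, correlationMatrix (block {x} {y₀, y₁} (√2)⁻¹ C) r s *
      (ofCorrelators A B C).toMatrix r s = √2 / 2 := by
  simp only [sum_correlationMatrix_mul, correlator_ofCorrelators]
  rw [sum_block_mul_self, Finset.card_pair (h.columns_ne hC)]
  · have : (√2)⁻¹ * 2 = √2 := by
      rw [inv_mul_eq_div, Real.div_sqrt]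
    simp [this]
  · simp [-sq_eq_one_iff, hC _ _ hx h.right₀, hC _ _ hx h.right₁]

theorem sqrt_two_sub_one_le_traceNorm_sub (h : IsCHSHBlock A B C x₀ x₁ y₀ y₁)
    (hC : ∀ x y, A x = 0 → B y = 0 → C x y ^ 2 = 1) {Q : Behaviour mA mB 2 2}
    (hQ : Q ∈ quantumSet.{u} mA mB 2 2) :
    √2 - 1 ≤ traceNorm ((ofCorrelators A B C).toMatrix - Q.toMatrix) := by
  have hbi := isBiorthogonal_correlationMatrix (h.isBiorthogonal_rows hC (√2)⁻¹)
  refine le_trans ?_ (sum_le_traceNorm _ ![correlationMatrix (block {x₀} {y₀, y₁} (√2)⁻¹ C),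
    correlationMatrix (block {x₁} {y₀, y₁} (√2)⁻¹ C)] ?_ ?_)
  · have htsir := chsh_le_of_mem_quantumSet hQ x₀ x₁ y₀ y₁ (hC _ _ h.left₀ h.right₀)
      (hC _ _ h.left₀ h.right₁) (hC _ _ h.left₁ h.right₀) (hC _ _ h.left₁ h.right₁) h.frustrated
    simp only [Fin.sum_univ_two, cons_val_zero, cons_val_one, Matrix.sub_apply, mul_sub,
      Finset.sum_sub_distrib, h.sum_row_mul hC h.left₀, h.sum_row_mul hC h.left₁,
      sum_correlationMatrix_mul, sum_block_mul, Finset.sum_singleton,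
      Finset.sum_pair (h.columns_ne hC)]
    -- The witness has value 2·√2/2 = √2 on the box and CHSH/(2√2) ≤ 1 on `Q`.
    have := mul_le_mul_of_nonneg_left htsir (inv_nonneg.2 (Real.sqrt_nonneg 2))
    have h2 : (√2)⁻¹ * (2 * √2) = 2 := by
      field_simp
    nlinarith
  · simp [Fin.forall_fin_two, h.sum_row_sq hC h.left₀, h.sum_row_sq hC h.left₁]
  · simp [Fin.forall_fin_two, hbi, hbi.symm]

theorem sub_one_le_traceNorm {m : ℕ} {A B : Fin m → ℝ} {C : Fin m → Fin m → ℝ}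
    {x₀ x₁ y₀ y₁ : Fin m} (h : IsCHSHBlock A B C x₀ x₁ y₀ y₁)
    (hA : ∀ x, A x = 0 ∨ A x ^ 2 = 1) (hB : ∀ y, B y = 0 ∨ B y ^ 2 = 1)
    (hAB : ∀ x y, A x ^ 2 = 1 ∨ B y ^ 2 = 1 → C x y = A x * B y)
    (hC : ∀ x y, A x = 0 → B y = 0 → C x y ^ 2 = 1)
    (hdet : ∑ x, A x ^ 2 = ∑ y, B y ^ 2) :
    (m : ℝ) + √2 - 1 ≤ traceNorm (ofCorrelators A B C).toMatrix := by
  set k := ∑ x, A x ^ 2 with hk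
  have hk0 : 0 ≤ k := Finset.sum_nonneg fun x _ => sq_nonneg _
  have hm : 0 < (m : ℝ) := Nat.cast_pos.2 (Fin.pos x₀)
  -- For either party: m - k uniform inputs, two of which lie in the block. By `hdet`, the same k
  -- serves both, so the remaining sign block is square.
  have hcard : ∀ {v : Fin m → ℝ} {z₀ z₁ : Fin m}, (∀ z, v z = 0 ∨ v z ^ 2 = 1) → v z₀ = 0 →
      v z₁ = 0 → z₀ ≠ z₁ → ∑ z, v z ^ 2 = k →
      (((Finset.univ.filter fun z => v z = 0) \ {z₀, z₁}).card : ℝ) = m - k - 2 := by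
    intro v z₀ z₁ hv h₀ h₁ hne hsum
    have hsub : ({z₀, z₁} : Finset (Fin m)) ⊆ Finset.univ.filter fun z => v z = 0 := by
      intro z hz
      rcases Finset.mem_insert.1 hz with rfl | hz
      · simp [h₀]
      · simp [Finset.mem_singleton.1 hz, h₁]
    have hzero : ((Finset.univ.filter fun z => v z = 0).card : ℝ) = m - k := by
      rw [Finset.card_filter, ← hsum]
      push_cast
      have : ∀ z, (if v z = 0 then (1 : ℝ) else 0) = 1 - v z ^ 2 := fun z => by
        rcases hv z with h | h
        · simp [h]
        · rw [if_neg (fun h0 => by simp [h0] at h), h, sub_self]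
      simp [this, Finset.sum_sub_distrib]
    rw [Finset.cast_card_sdiff hsub, hzero, Finset.card_pair hne]
    norm_num
  have hSc := hcard hA h.left₀ h.left₁ (h.rows_ne hC) rfl
  have hTc := hcard hB h.right₀ h.right₁ (h.columns_ne hC) hdet.symm
  set S := (Finset.univ.filter fun x => A x = 0) \ {x₀, x₁} with hS
  set T := (Finset.univ.filter fun y => B y = 0) \ {y₀, y₁} with hT
  have hSA : ∀ x ∈ S, A x = 0 := fun x hx => by simpa using (Finset.mem_sdiff.1 hx).1
  have hTB : ∀ y ∈ T, B y = 0 := fun y hy => by simpa using (Finset.mem_sdiff.1 hy).1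
  have hdT : Disjoint {y₀, y₁} T := Finset.disjoint_sdiff
  have hdS : Disjoint {x₀, x₁} S := Finset.disjoint_sdiff
  have hdS₀ : Disjoint {x₀} S := hdS.mono_left (by simp)
  have hdS₁ : Disjoint {x₁} S := hdS.mono_left (by simp)
  have hSTC : ∀ x ∈ S, ∀ y ∈ T, C x y ^ 2 = 1 := fun x hx y hy => hC x y (hSA x hx) (hTB y hy)
  have hrow : ∀ x, A x = 0 → IsBiorthogonal (marginalMatrix (m + k)⁻¹ A B)
      (correlationMatrix (block {x} {y₀, y₁} (√2)⁻¹ C)) := fun x hx =>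
    isBiorthogonal_marginalMatrix_correlationMatrix _
      (mul_block_eq_zero _ _ (v := fun x _ => A x) (by simp [hx]))
      (mul_block_eq_zero _ _ (v := fun _ y => B y) (by simp [h.right₀, h.right₁]))
  have hb01 := hrow x₀ h.left₀
  have hb02 := hrow x₁ h.left₁
  have hb03 : IsBiorthogonal (marginalMatrix (m + k)⁻¹ A B)
      (correlationMatrix (block S T (m - k - 2)⁻¹ C)) :=
    isBiorthogonal_marginalMatrix_correlationMatrix _
      (mul_block_eq_zero _ _ (v := fun x _ => A x) fun x hx _ _ => hSA x hx)
      (mul_block_eq_zero _ _ (v := fun _ y => B y) fun _ _ y hy => hTB y hy)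
  have hb12 := isBiorthogonal_correlationMatrix (h.isBiorthogonal_rows hC (√2)⁻¹)
  have hb13 := isBiorthogonal_correlationMatrix
    (isBiorthogonal_block hdS₀ hdT (√2)⁻¹ (m - k - 2)⁻¹ C C)
  have hb23 := isBiorthogonal_correlationMatrix
    (isBiorthogonal_block hdS₁ hdT (√2)⁻¹ (m - k - 2)⁻¹ C C)
  -- This includes t = 0: when the block exhausts the uniform inputs, m - k - 2 = 0 and the last
  -- piece is zero.
  have hinv : ∀ t : ℝ, t⁻¹ * (t * t) = t := fun t => by rw [← mul_assoc, inv_mul_mul_self]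
  have hsumA : ∑ x, (1 + A x ^ 2) = m + k := by simp [Finset.sum_add_distrib, hk]
  have hsumB : ∑ y, (1 + B y ^ 2) = m + k := by simp [Finset.sum_add_distrib, hdet]
  refine le_trans ?_ (sum_le_traceNorm _ ![marginalMatrix (m + k)⁻¹ A B,
    correlationMatrix (block {x₀} {y₀, y₁} (√2)⁻¹ C),
    correlationMatrix (block {x₁} {y₀, y₁} (√2)⁻¹ C),
    correlationMatrix (block S T (m - k - 2)⁻¹ C)] ?_ ?_)
  · rw [Fin.sum_univ_four]
    simp only [cons_val]
    rw [h.sum_row_mul hC h.left₀, h.sum_row_mul hC h.left₁, sum_correlationMatrix_mul,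
      sum_marginalMatrix_mul, hsumA, hsumB]
    · simp only [correlator_ofCorrelators]
      rw [sum_block_mul_self _ hSTC, hSc, hTc, hinv, hinv]
      -- (m+k)/2 + √2/2 + √2/2 + (m-k-2)/2 = m + √2 - 1.
      linarith
    · intro x y
      rcases hA x with hx | hx
      · simp [hx]
      · rw [hAB x y (.inl hx)]
        ring
  · intro j
    fin_cases j
    · change ∑ r, ∑ s, marginalMatrix (m + k)⁻¹ A B r s ^ 2 ≤ 1
      rw [sum_marginalMatrix_sq, hsumA, hsumB, ← sq, ← mul_pow, inv_mul_cancel₀ (by positivity),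
        one_pow]
    · exact (h.sum_row_sq hC h.left₀).le
    · exact (h.sum_row_sq hC h.left₁).le
    · change ∑ r, ∑ s, correlationMatrix (block S T (m - k - 2)⁻¹ C) r s ^ 2 ≤ 1
      rw [sum_correlationMatrix_sq, sum_block_sq _ hSTC, hSc, hTc, ← sq, ← mul_pow]
      exact pow_le_one₀ (by rw [← hSc]; positivity) inv_mul_le_one
  · intro j l hjl
    fin_cases j <;> fin_cases l <;>
      first
        | exact absurd rfl hjl
        | exact hb01
        | exact hb02
        | exact hb03
        | exact hb12
        | exact hb13
        | exact hb23
        | exact hb01.symm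
        | exact hb02.symm
        | exact hb03.symm
        | exact hb12.symm
        | exact hb13.symm
        | exact hb23.symm

end CHSH

end Witness

end

end Bell

theorem theorem5 (m : ℕ) (P : Bell.Behaviour m m 2 2) (hP : Bell.IsPRBox P) :
    (Bell.numDeterministicA P = Bell.numDeterministicB P →
      (m : ℝ) + √2 - 1 ≤ Bell.traceNorm P.toMatrix) ∧
    (∀ Q ∈ Bell.quantumSet.{u} m m 2 2,
      √2 - 1 ≤ Bell.traceNorm (P.toMatrix - Q.toMatrix)) := by
  obtain ⟨A, B, C, rfl, hA, hB, hAB, hC, x₀, x₁, y₀, y₁, h⟩ := hP.exists_ofCorrelators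
  refine ⟨fun hdet => ?_, fun Q hQ => Bell.sqrt_two_sub_one_le_traceNorm_sub h hC hQ⟩
  refine Bell.sub_one_le_traceNorm h hA hB hAB hC ?_
  rw [← Bell.numDeterministicA_ofCorrelators hA B C y₀,
    ← Bell.numDeterministicB_ofCorrelators A hB C x₀, hdet]
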